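/- Let $A\in\mathbb{R}^{m\times n}$ have full column rank, $\operatorname{rank}(A)=n$, with $0<\operatorname{rank}(A)<m$. Write $\mathbb{R}^m_{>0}$ for the vectors with positive coordinates. For $x\in\mathbb{R}^m$ let the corresponding capital letter denote $X=\mathrm{Diag}(x)$. For $s\in\mathbb{R}^m_{>0}$ put $A_s=S^{-1}A$, and for a matrix $M$ put $\|x\|_M=\sqrt{x^TMx}$. Set $$\alpha=1-\frac{1}{\log_2(2m/\operatorname{rank}(A))},\qquad \beta=\frac{\operatorname{rank}(A)}{2m}.$$ Then for every $s\in\mathbb{R}^m_{>0}$ the function $$w\mapsto \mathbf 1^Tw-\frac1\alpha\log\det\left(A_s^TW^\alpha A_s\right)-\beta\sum_{i=1}^m\log w_i$$ has a unique minimizer $g(s)$ over $w\in\mathbb{R}^m_{>0}$. The resulting function $g:\mathbb{R}^m_{>0}\to\mathbb{R}^m_{>0}$ is a differentiable weight function with size $c_1=2\operatorname{rank}(A)$, slack sensitivity $c_\gamma=2$ and step consistency $c_r=2\log_2(2m/\operatorname{rank}(A))$. That is, $g$ is differentiable, $c_\gamma\ge 1$, $c_r\ge1$, and for all $s\in\mathbb{R}^m_{>0}$,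 with $G=\mathrm{Diag}(g(s))$ and $G'$ the Jacobian matrix of $g$ at $s$: 1. (Size) $\|g(s)\|_1\le c_1$. 2. (Slack sensitivity) $\max_{i}\|G^{-1/2}e_i\|_{P}\le c_\gamma$, where $P=G^{1/2}A_s(A_s^TGA_s)^{-1}A_s^TG^{1/2}$. 3. (Step consistency) For all real $r\ge c_r$ and all $y\in\mathbb{R}^m$, $$\left\|I+r^{-1}G^{-1}G'S\right\|_{G}\le1\quad\text{and}\quad\left\|\left(I+r^{-1}G^{-1}G'S\right)y\right\|_\infty\le\|y\|_\infty+c_r\|y\|_{G},$$ where the first norm is the operator norm induced by $\|\cdot\|_G$. 4. (Uniformity) $\|g(s)\|_\infty\le2$. -/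

import Mathlib

open Matrix
open scoped ENNReal

noncomputable section

namespace WeightedPath

variable {m n : ℕ}

/-- The vectors of `ℝᵐ` all of whose coordinates are positive. -/
def posOrthant (m : ℕ) : Set (Fin m → ℝ) := {x | ∀ i, 0 < x i}

/-- `diagPow x p` is the diagonal matrix `Xᵖ`, where `X = Diag(x)`. -/
def diagPow (x : Fin m → ℝ) (p : ℝ) : Matrix (Fin m) (Fin m) ℝ :=
  Matrix.diagonal fun i => x i ^ p

/-- `A_s = S⁻¹ A`, where `S = Diag(s)`. -/
def scaledMatrix (A : Matrix (Fin m) (Fin n) ℝ) (s : Fin m → ℝ) : Matrix (Fin m) (Fin n) ℝ :=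
  (Matrix.diagonal s)⁻¹ * A

/-- `‖x‖_M = √(xᵀ M x)`. -/
def energyNorm (M : Matrix (Fin m) (Fin m) ℝ) (x : Fin m → ℝ) : ℝ :=
  Real.sqrt (x ⬝ᵥ (M *ᵥ x))

/-- The operator norm of `B` induced by `‖·‖_M`, with values in `[0, ∞]`. -/
def energyOpNorm (M B : Matrix (Fin m) (Fin m) ℝ) : ℝ≥0∞ :=
  ⨆ (y : Fin m → ℝ) (_ : energyNorm M y ≤ 1), ENNReal.ofReal (energyNorm M (B *ᵥ y))

/-- The projection matrix `P_A(x) = X^{1/2} A (Aᵀ X A)⁻¹ Aᵀ X^{1/2}`. -/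
def projMatrix (A : Matrix (Fin m) (Fin n) ℝ) (x : Fin m → ℝ) : Matrix (Fin m) (Fin m) ℝ :=
  diagPow x (1 / 2) * A * (Aᵀ * Matrix.diagonal x * A)⁻¹ * Aᵀ * diagPow x (1 / 2)

/-- The slack sensitivity `γ(s, w) = max_i ‖W^{-1/2} e_i‖_{P_{S⁻¹A}(w)}`. -/
def slackSensitivity (A : Matrix (Fin m) (Fin n) ℝ) (s w : Fin m → ℝ) : ℝ :=
  ⨆ i : Fin m, energyNorm (projMatrix (scaledMatrix A s) w)
    (diagPow w (-(1 / 2)) *ᵥ Pi.single i 1)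

/-- The Jacobian matrix of `g` at `s`. -/
def jacobian (g : (Fin m → ℝ) → (Fin m → ℝ)) (s : Fin m → ℝ) : Matrix (Fin m) (Fin m) ℝ :=
  Matrix.of fun i j => fderiv ℝ g s (Pi.single j 1) i

/-- The matrix `I + r⁻¹ G(s)⁻¹ G'(s) S`, where `G(s) = Diag(g(s))` and `G'(s)` is the Jacobian. -/
def stepMatrix (g : (Fin m → ℝ) → (Fin m → ℝ)) (s : Fin m → ℝ) (r : ℝ) :
    Matrix (Fin m) (Fin m) ℝ :=
  1 + r⁻¹ • ((Matrix.diagonal (g s))⁻¹ * jacobian g s * Matrix.diagonal s)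

/-- `g` is a (differentiable) weight function for `A` with size `cSize`, slack sensitivity `cStab`
and step consistency `cCons`. Only the values of `g` on the open positive orthant matter.
On `Fin m → ℝ` the norm `‖·‖` is the `ℓ_∞` norm. -/
structure IsWeightFunction (A : Matrix (Fin m) (Fin n) ℝ) (g : (Fin m → ℝ) → (Fin m → ℝ))
    (cSize cStab cCons : ℝ) : Prop where
  mapsTo : Set.MapsTo g (posOrthant m) (posOrthant m)
  differentiable : ∀ s ∈ posOrthant m, DifferentiableAt ℝ g s
  size : ∀ s ∈ posOrthant m, ∑ i, |g s i| ≤ cSize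
  one_le_stab : 1 ≤ cStab
  stab : ∀ s ∈ posOrthant m, slackSensitivity A s (g s) ≤ cStab
  one_le_cons : 1 ≤ cCons
  cons_energy : ∀ s ∈ posOrthant m, ∀ r : ℝ, cCons ≤ r →
    energyOpNorm (Matrix.diagonal (g s)) (stepMatrix g s r) ≤ 1
  cons_sup : ∀ s ∈ posOrthant m, ∀ r : ℝ, cCons ≤ r → ∀ y : Fin m → ℝ,
    ‖stepMatrix g s r *ᵥ y‖ ≤ ‖y‖ + cCons * energyNorm (Matrix.diagonal (g s)) y
  uniform : ∀ s ∈ posOrthant m, ‖g s‖ ≤ 2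

/-- The objective
`1ᵀ w - (1/α) log det (A_sᵀ W^α A_s) - β ∑ i, log w_i`. -/
def weightObjective (A : Matrix (Fin m) (Fin n) ℝ) (α β : ℝ) (s w : Fin m → ℝ) : ℝ :=
  (∑ i, w i)
    - 1 / α * Real.log ((scaledMatrix A s)ᵀ * diagPow w α * scaledMatrix A s).det
    - β * ∑ i, Real.log (w i)

/-- `w` minimizes the objective at slacks `s` over all positive weight vectors. -/
def IsOptimalWeight (A : Matrix (Fin m) (Fin n) ℝ) (α β : ℝ) (s w : Fin m → ℝ) : Prop :=
  w ∈ posOrthant m ∧ IsMinOn (weightObjective A α β s) (posOrthant m) w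

end WeightedPath

end

/-!
For positive weights `z` let `K(z) = A (Aᵀ Z A)⁻¹ Aᵀ`, with leverage scores `σ_i(z) = z_i K(z)_ii`.
Put `z = w^α / s²`, so that `A_sᵀ W^α A_s = Aᵀ Z A`; the gradient of the objective at `w` is
`(w_i - σ_i(z) - β) / w_i`.

*Existence and uniqueness.* Concavity of `log det` and of `t ↦ t^α` give the tangent-plane
inequality `le_weightObjective_sub`, strict because of the barrier `-β ∑ log w_i`. Hence a critical
weight vector `w = σ(z) + β` is the unique minimizer. As `0 ≤ σ_i ≤ 1`, a minimizer over the compact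
box `[β, 1 + β]ᵐ` can be tested against the point `σ(z) + β` of that box, which forces it to be
critical (`exists_isCriticalWeight`). Size, uniformity and slack sensitivity follow from
`w = σ(z) + β` together with `0 ≤ σ_i ≤ 1`, `∑ σ_i = n` and `β^{1 - α} = 1 / 2`.

*Differentiability.* The optimality condition is solved explicitly by taking `z` as the parameter:
`w = σ(z) + β` and `log s = (α log w - log z) / 2`. In the coordinates `log z ↦ log s` this map has
derivative `-(I - α B) / 2`, where `B = W⁻¹ Λ` and `Λ = Σ - P ∘ P` is the derivative of
`log z ↦ σ(z)`. Uniqueness provides a left inverse of the map, so the inverse function theorem gives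
`G⁻¹ G' S = -2 B (I - α B)⁻¹` (`differentiableAt_optimalWeight`).

*Step consistency.* `Λ` is a graph Laplacian, hence `0 ≤ Λ`, and `P ∘ P` is positive semidefinite by
the Schur product theorem, hence `Λ ≤ Σ ≤ W`. So `B` is self-adjoint for `‖·‖_W` with spectrum in
`[0, 1]`, and `I - (2 / r) B (I - α B)⁻¹` has spectrum in `[0, 1]` once `2 / r ≤ 1 - α`. For the sup
norm, the diagonal part of this matrix lies in `[0, 1]`, and the remainder is bounded by
Cauchy-Schwarz through `P_ij² ≤ σ_i σ_j` (`abs_resolvent_step_le`).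
-/

noncomputable section

namespace WeightedPath

variable {m n : ℕ} {A : Matrix (Fin m) (Fin n) ℝ} {z z' w s : Fin m → ℝ} {α β : ℝ}

/-! ### The leverage kernel -/

/-- The Gram matrix `Aᵀ Z A`, where `Z = Diag(z)`. -/
def gram (A : Matrix (Fin m) (Fin n) ℝ) (z : Fin m → ℝ) : Matrix (Fin n) (Fin n) ℝ :=
  Aᵀ * diagonal z * A

/-- The kernel `K(z) = A (Aᵀ Z A)⁻¹ Aᵀ`. The projection onto the column space of `Z^{1/2} A` is
`Z^{1/2} K(z) Z^{1/2}`; working with `K` avoids the square roots. -/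
def leverageKernel (A : Matrix (Fin m) (Fin n) ℝ) (z : Fin m → ℝ) : Matrix (Fin m) (Fin m) ℝ :=
  A * (gram A z)⁻¹ * Aᵀ

/-- The leverage score `σ_i(z)` of the `i`-th row of `Z^{1/2} A`. -/
def leverage (A : Matrix (Fin m) (Fin n) ℝ) (z : Fin m → ℝ) (i : Fin m) : ℝ :=
  z i * leverageKernel A z i i

lemma gram_posDef (hA : A.rank = n) (hz : z ∈ posOrthant m) : (gram A z).PosDef := by
  have hinj : Function.Injective A.mulVec := by
    have h := LinearMap.finrank_range_add_finrank_ker A.mulVecLin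
    rw [show Module.finrank ℝ (LinearMap.range A.mulVecLin) = n from hA] at h
    have h0 : Module.finrank ℝ (LinearMap.ker A.mulVecLin) = 0 := by
      simpa using h
    exact LinearMap.ker_eq_bot.1 (Submodule.finrank_eq_zero.1 h0)
  have := (PosDef.diagonal hz).conjTranspose_mul_mul_same (B := A) hinj
  rwa [conjTranspose_eq_transpose_of_trivial] at this

lemma isUnit_gram_det (hA : A.rank = n) (hz : z ∈ posOrthant m) : IsUnit (gram A z).det :=
  (gram_posDef hA hz).det_pos.ne'.isUnit

lemma leverageKernel_comm (A : Matrix (Fin m) (Fin n) ℝ) (z : Fin m → ℝ) (i j : Fin m) :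
    leverageKernel A z i j = leverageKernel A z j i := by
  have h : (leverageKernel A z)ᵀ = leverageKernel A z := by
    simp [leverageKernel, gram, transpose_mul, transpose_nonsing_inv, Matrix.mul_assoc]
  exact congrFun (congrFun h j) i

/-- The entries of the identity `K(z') Z K(z) = K(z')`. -/
lemma sum_leverageKernel_mul (hA : A.rank = n) (hz : z ∈ posOrthant m) (z' : Fin m → ℝ)
    (i j : Fin m) :
    ∑ k, leverageKernel A z' i k * z k * leverageKernel A z k j = leverageKernel A z' i j := by
  have h : leverageKernel A z' * diagonal z * leverageKernel A z = leverageKernel A z' := by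
    calc leverageKernel A z' * diagonal z * leverageKernel A z
        = A * (gram A z')⁻¹ * (gram A z * (gram A z)⁻¹) * Aᵀ := by
          simp only [leverageKernel, gram, Matrix.mul_assoc]
      _ = leverageKernel A z' := by
          rw [mul_nonsing_inv _ (isUnit_gram_det hA hz), Matrix.mul_one, leverageKernel]
  have := congrFun (congrFun h i) j
  rwa [Matrix.mul_apply, Finset.sum_congr rfl fun k _ => by rw [mul_diagonal]] at this

/-- The rows of the projection `Z^{1/2} K Z^{1/2}` have squared length equal to its diagonal
entries. -/
lemma sum_mul_leverageKernel_sq (hA : A.rank = n) (hz : z ∈ posOrthant m) (i : Fin m) :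
    ∑ k, z k * leverageKernel A z i k ^ 2 = leverageKernel A z i i := by
  rw [← sum_leverageKernel_mul hA hz z i i]
  exact Finset.sum_congr rfl fun k _ => by rw [leverageKernel_comm A z k i]; ring

lemma leverageKernel_diag_nonneg (hA : A.rank = n) (hz : z ∈ posOrthant m) (i : Fin m) :
    0 ≤ leverageKernel A z i i := by
  rw [← sum_mul_leverageKernel_sq hA hz]
  exact Finset.sum_nonneg fun k _ => mul_nonneg (hz k).le (sq_nonneg _)

lemma leverage_nonneg (hA : A.rank = n) (hz : z ∈ posOrthant m) (i : Fin m) :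
    0 ≤ leverage A z i :=
  mul_nonneg (hz i).le (leverageKernel_diag_nonneg hA hz i)

lemma leverage_le_one (hA : A.rank = n) (hz : z ∈ posOrthant m) (i : Fin m) :
    leverage A z i ≤ 1 := by
  have h := Finset.single_le_sum (f := fun k => z k * leverageKernel A z i k ^ 2)
    (fun k _ => mul_nonneg (hz k).le (sq_nonneg _)) (Finset.mem_univ i)
  simp only [sum_mul_leverageKernel_sq hA hz] at h
  have h0 := leverageKernel_diag_nonneg hA hz i
  rcases h0.eq_or_lt with h0 | h0
  · simp [leverage, ← h0]
  · unfold leverage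
    by_contra! hc
    nlinarith [mul_lt_mul_of_pos_right hc h0]

lemma trace_gram_inv_mul_gram (A : Matrix (Fin m) (Fin n) ℝ) (z z' : Fin m → ℝ) :
    ((gram A z)⁻¹ * gram A z').trace = ∑ i, z' i * leverageKernel A z i i := by
  calc ((gram A z)⁻¹ * gram A z').trace
      = ((gram A z)⁻¹ * Aᵀ * diagonal z' * A).trace := by simp only [gram, Matrix.mul_assoc]
    _ = (leverageKernel A z * diagonal z').trace := by
        rw [Matrix.trace_mul_comm, leverageKernel]; simp only [Matrix.mul_assoc]
    _ = ∑ i, z' i * leverageKernel A z i i := by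
        simp [Matrix.trace, mul_diagonal, mul_comm]

lemma sum_leverage (hA : A.rank = n) (hz : z ∈ posOrthant m) : ∑ i, leverage A z i = n := by
  have h := trace_gram_inv_mul_gram A z z
  rw [nonsing_inv_mul _ (isUnit_gram_det hA hz)] at h
  simpa [leverage] using h.symm

/-- The diagonal of the kernel is antitone in the weights, up to scaling: this is
`0 ≤ ‖K(z') e_i - c K(z) e_i‖²_Z` expanded. -/
lemma leverageKernel_diag_le (hA : A.rank = n) (hz : z ∈ posOrthant m) (hz' : z' ∈ posOrthant m)
    {c : ℝ} (hc : 0 < c) (h : ∀ k, z k ≤ c * z' k) (i : Fin m) :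
    leverageKernel A z' i i ≤ c * leverageKernel A z i i := by
  have h1 : ∑ k, z k * leverageKernel A z' i k ^ 2 ≤ c * leverageKernel A z' i i := by
    rw [← sum_mul_leverageKernel_sq hA hz', Finset.mul_sum]
    refine Finset.sum_le_sum fun k _ => ?_
    rw [← mul_assoc]
    exact mul_le_mul_of_nonneg_right (h k) (sq_nonneg _)
  have h2 := sum_leverageKernel_mul hA hz z' i i
  have h3 := sum_mul_leverageKernel_sq hA hz i
  have h4 : 0 ≤ ∑ k, z k * (leverageKernel A z' i k - c * leverageKernel A z i k) ^ 2 :=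
    Finset.sum_nonneg fun k _ => mul_nonneg (hz k).le (sq_nonneg _)
  have h5 : ∑ k, z k * (leverageKernel A z' i k - c * leverageKernel A z i k) ^ 2
      = ∑ k, z k * leverageKernel A z' i k ^ 2
        - 2 * c * ∑ k, leverageKernel A z' i k * z k * leverageKernel A z k i
        + c ^ 2 * ∑ k, z k * leverageKernel A z i k ^ 2 := by
    rw [Finset.mul_sum, Finset.mul_sum, ← Finset.sum_sub_distrib, ← Finset.sum_add_distrib]
    exact Finset.sum_congr rfl fun k _ => by rw [leverageKernel_comm A z k i]; ring
  rw [h2, h3] at h5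
  by_contra! hlt
  nlinarith [mul_lt_mul_of_pos_left hlt hc]

/-- `P_ij² = z_i z_j K_ij²` is dominated by the product of the leverage scores. -/
lemma mul_leverageKernel_sq_le (hA : A.rank = n) (hz : z ∈ posOrthant m) (i j : Fin m) :
    z i * z j * leverageKernel A z i j ^ 2 ≤ leverage A z i * leverage A z j := by
  have h : leverageKernel A z i j ^ 2 ≤ leverageKernel A z i i * leverageKernel A z j j := by
    rw [← sum_leverageKernel_mul hA hz z i j, ← sum_mul_leverageKernel_sq hA hz i,
      ← sum_mul_leverageKernel_sq hA hz j]
    refine Finset.sum_sq_le_sum_mul_sum_of_sq_le_mul _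
      (fun k _ => mul_nonneg (hz k).le (sq_nonneg _))
      (fun k _ => mul_nonneg (hz k).le (sq_nonneg _)) fun k _ => ?_
    rw [leverageKernel_comm A z k j]
    exact le_of_eq (by ring)
  have := mul_le_mul_of_nonneg_left h (mul_nonneg (hz i).le (hz j).le)
  calc _ ≤ _ := this
    _ = _ := by unfold leverage; ring

lemma sum_mul_leverageKernel_sq_eq_leverage (hA : A.rank = n) (hz : z ∈ posOrthant m)
    (i : Fin m) : ∑ j, z i * z j * leverageKernel A z i j ^ 2 = leverage A z i := by
  rw [leverage, ← sum_mul_leverageKernel_sq hA hz i, Finset.mul_sum]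
  exact Finset.sum_congr rfl fun j _ => by ring

/-! ### The leverage Laplacian -/

/-- The vector `Λ u`, where `Λ = Σ - P ∘ P` is the derivative of `log z ↦ σ(z)`: `Σ` is the
diagonal matrix of leverage scores and `P ∘ P` has entries `z_i z_j K_ij²`. -/
def leverageLaplacian (A : Matrix (Fin m) (Fin n) ℝ) (z u : Fin m → ℝ) (i : Fin m) : ℝ :=
  leverage A z i * u i - ∑ j, z i * z j * leverageKernel A z i j ^ 2 * u j

lemma leverageLaplacian_sub (A : Matrix (Fin m) (Fin n) ℝ) (z u v : Fin m → ℝ) (i : Fin m) :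
    leverageLaplacian A z (u - v) i = leverageLaplacian A z u i - leverageLaplacian A z v i := by
  simp only [leverageLaplacian, Pi.sub_apply, mul_sub, Finset.sum_sub_distrib]
  ring

lemma leverageLaplacian_smul (A : Matrix (Fin m) (Fin n) ℝ) (z u : Fin m → ℝ) (c : ℝ)
    (i : Fin m) :
    leverageLaplacian A z (c • u) i = c * leverageLaplacian A z u i := by
  simp only [leverageLaplacian, Pi.smul_apply, smul_eq_mul, mul_sub, Finset.mul_sum]
  congr 1
  · ring
  · exact Finset.sum_congr rfl fun j _ => by ring

lemma leverageLaplacian_symm (A : Matrix (Fin m) (Fin n) ℝ) (z u v : Fin m → ℝ) :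
    ∑ i, u i * leverageLaplacian A z v i = ∑ i, v i * leverageLaplacian A z u i := by
  simp only [leverageLaplacian, mul_sub, Finset.sum_sub_distrib, Finset.mul_sum]
  congr 1
  · exact Finset.sum_congr rfl fun i _ => by ring
  · rw [Finset.sum_comm]
    exact Finset.sum_congr rfl fun i _ => Finset.sum_congr rfl fun j _ => by
      rw [leverageKernel_comm A z i j]; ring

/-- `Λ` is positive semidefinite: `2 uᵀ Λ u = ∑ P_ij² (u_i - u_j)²`. -/
lemma leverageLaplacian_nonneg (hA : A.rank = n) (hz : z ∈ posOrthant m) (u : Fin m → ℝ) :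
    0 ≤ ∑ i, u i * leverageLaplacian A z u i := by
  have h0 : 0 ≤ ∑ i, ∑ j, z i * z j * leverageKernel A z i j ^ 2 * (u i - u j) ^ 2 :=
    Finset.sum_nonneg fun i _ => Finset.sum_nonneg fun j _ =>
      mul_nonneg (mul_nonneg (mul_nonneg (hz i).le (hz j).le) (sq_nonneg _)) (sq_nonneg _)
  have h1 : ∑ i, ∑ j, z i * z j * leverageKernel A z i j ^ 2 * (u i - u j) ^ 2
      = ∑ i, ∑ j, z i * z j * leverageKernel A z i j ^ 2 * u i ^ 2
        + ∑ i, ∑ j, z i * z j * leverageKernel A z i j ^ 2 * u j ^ 2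
        - 2 * ∑ i, ∑ j, u i * (z i * z j * leverageKernel A z i j ^ 2 * u j) := by
    simp only [Finset.mul_sum, ← Finset.sum_sub_distrib, ← Finset.sum_add_distrib]
    exact Finset.sum_congr rfl fun i _ => Finset.sum_congr rfl fun j _ => by ring
  have h2 : ∑ i, ∑ j, z i * z j * leverageKernel A z i j ^ 2 * u i ^ 2
      = ∑ i, leverage A z i * u i ^ 2 :=
    Finset.sum_congr rfl fun i _ => by
      rw [← Finset.sum_mul, sum_mul_leverageKernel_sq_eq_leverage hA hz]
  have h3 : ∑ i, ∑ j, z i * z j * leverageKernel A z i j ^ 2 * u j ^ 2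
      = ∑ i, leverage A z i * u i ^ 2 := by
    rw [← h2, Finset.sum_comm]
    exact Finset.sum_congr rfl fun i _ => Finset.sum_congr rfl fun j _ => by
      rw [leverageKernel_comm A z i j]; ring
  have h4 : ∑ i, u i * leverageLaplacian A z u i = ∑ i, leverage A z i * u i ^ 2
      - ∑ i, ∑ j, u i * (z i * z j * leverageKernel A z i j ^ 2 * u j) := by
    simp only [leverageLaplacian, mul_sub, Finset.sum_sub_distrib, Finset.mul_sum]
    congr 1
    exact Finset.sum_congr rfl fun i _ => by ring
  linarith

/-- The Hadamard square `P ∘ P` is positive semidefinite (Schur product theorem). -/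
lemma hadamard_sq_nonneg (hA : A.rank = n) (hz : z ∈ posOrthant m) (u : Fin m → ℝ) :
    0 ≤ ∑ i, u i * ∑ j, z i * z j * leverageKernel A z i j ^ 2 * u j := by
  have hK : (leverageKernel A z).PosSemidef := by
    have := (gram_posDef hA hz).inv.posSemidef.mul_mul_conjTranspose_same A
    rwa [conjTranspose_eq_transpose_of_trivial] at this
  have := (hK.hadamard hK).dotProduct_mulVec_nonneg (fun i => z i * u i)
  refine this.trans_eq ?_
  simp only [dotProduct, mulVec, Pi.star_apply, star_trivial, hadamard_apply, Finset.mul_sum]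
  exact Finset.sum_congr rfl fun i _ => Finset.sum_congr rfl fun j _ => by ring

lemma leverageLaplacian_le (hA : A.rank = n) (hz : z ∈ posOrthant m) (u : Fin m → ℝ) :
    ∑ i, u i * leverageLaplacian A z u i ≤ ∑ i, leverage A z i * u i ^ 2 := by
  have h := hadamard_sq_nonneg hA hz u
  have h4 : ∑ i, u i * leverageLaplacian A z u i = ∑ i, leverage A z i * u i ^ 2
      - ∑ i, u i * ∑ j, z i * z j * leverageKernel A z i j ^ 2 * u j := by
    simp only [leverageLaplacian, mul_sub, Finset.sum_sub_distrib]
    congr 1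
    exact Finset.sum_congr rfl fun i _ => by ring
  linarith

/-! ### Resolvent estimates

Let `B = W⁻¹ Λ`, with `W` dominating the leverage scores, and `y = u - α B u`. The operator `B` is
self-adjoint for `⟨u, v⟩_W = uᵀ W v`, with spectrum in `[0, 1]`. -/

/-- The vector `B u = W⁻¹ Λ u`. -/
def scaledLaplacian (A : Matrix (Fin m) (Fin n) ℝ) (z w u : Fin m → ℝ) (i : Fin m) : ℝ :=
  leverageLaplacian A z u i / w i

/-- `⟨B u, B u⟩_W ≤ ⟨u, B u⟩_W`. -/
lemma sum_scaledLaplacian_sq_le (hA : A.rank = n) (hz : z ∈ posOrthant m) (hw : w ∈ posOrthant m)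
    (hσ : ∀ i, leverage A z i ≤ w i) (u : Fin m → ℝ) :
    ∑ i, w i * scaledLaplacian A z w u i ^ 2 ≤ ∑ i, w i * (u i * scaledLaplacian A z w u i) := by
  set b := scaledLaplacian A z w u with hb
  have hwb : ∀ i, w i * b i = leverageLaplacian A z u i := fun i =>
    mul_div_cancel₀ _ (hw i).ne'
  have e1 : ∑ i, w i * b i ^ 2 = ∑ i, b i * leverageLaplacian A z u i :=
    Finset.sum_congr rfl fun i _ => by rw [← hwb]; ring
  have e2 : ∑ i, w i * (u i * b i) = ∑ i, u i * leverageLaplacian A z u i :=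
    Finset.sum_congr rfl fun i _ => by rw [← hwb]; ring
  have h1 : ∑ i, b i * leverageLaplacian A z b i ≤ ∑ i, w i * b i ^ 2 :=
    (leverageLaplacian_le hA hz b).trans
      (Finset.sum_le_sum fun i _ => mul_le_mul_of_nonneg_right (hσ i) (sq_nonneg _))
  -- Positivity of `Λ` at `u - B u` gives the claim, since `Λ ≤ W`.
  have h2 := leverageLaplacian_nonneg hA hz (u - b)
  have h3 : ∑ i, (u - b) i * leverageLaplacian A z (u - b) i
      = ∑ i, u i * leverageLaplacian A z u i - ∑ i, u i * leverageLaplacian A z b i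
        - (∑ i, b i * leverageLaplacian A z u i - ∑ i, b i * leverageLaplacian A z b i) := by
    simp only [← Finset.sum_sub_distrib]
    exact Finset.sum_congr rfl fun i _ => by
      rw [leverageLaplacian_sub, Pi.sub_apply]; ring
  rw [leverageLaplacian_symm A z u b] at h3
  linarith

lemma sum_mul_scaledLaplacian_le (hA : A.rank = n) (hz : z ∈ posOrthant m)
    (hw : w ∈ posOrthant m) (hσ : ∀ i, leverage A z i ≤ w i) (u : Fin m → ℝ) :
    ∑ i, w i * (u i * scaledLaplacian A z w u i) ≤ ∑ i, w i * u i ^ 2 := by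
  calc ∑ i, w i * (u i * scaledLaplacian A z w u i)
      = ∑ i, u i * leverageLaplacian A z u i := Finset.sum_congr rfl fun i _ => by
        rw [scaledLaplacian]; field_simp [(hw i).ne']
    _ ≤ ∑ i, leverage A z i * u i ^ 2 := leverageLaplacian_le hA hz u
    _ ≤ _ := Finset.sum_le_sum fun i _ => mul_le_mul_of_nonneg_right (hσ i) (sq_nonneg _)

/-- `I - c B (I - α B)⁻¹` is a contraction for `‖·‖_W`. -/
lemma energy_resolvent_step_le (hA : A.rank = n) (hz : z ∈ posOrthant m) (hw : w ∈ posOrthant m)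
    (hσ : ∀ i, leverage A z i ≤ w i) {α c : ℝ} (hc : 0 ≤ c) (hαc : α + c ≤ 1)
    {u y : Fin m → ℝ} (hy : ∀ i, y i = u i - α * scaledLaplacian A z w u i) :
    ∑ i, w i * (y i - c * scaledLaplacian A z w u i) ^ 2 ≤ ∑ i, w i * y i ^ 2 := by
  have h1 := sum_scaledLaplacian_sq_le hA hz hw hσ u
  set b := scaledLaplacian A z w u
  have h0 : 0 ≤ ∑ i, w i * b i ^ 2 :=
    Finset.sum_nonneg fun i _ => mul_nonneg (hw i).le (sq_nonneg _)
  have e : ∑ i, w i * (y i - c * b i) ^ 2 = ∑ i, w i * y i ^ 2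
      + c * ((2 * α + c) * ∑ i, w i * b i ^ 2 - 2 * ∑ i, w i * (u i * b i)) := by
    simp only [Finset.mul_sum, ← Finset.sum_sub_distrib, ← Finset.sum_add_distrib]
    exact Finset.sum_congr rfl fun i _ => by rw [hy]; ring
  have h2 : (2 * α + c) * ∑ i, w i * b i ^ 2 ≤ 2 * ∑ i, w i * b i ^ 2 :=
    mul_le_mul_of_nonneg_right (by linarith) h0
  have h3 := mul_nonneg hc (show 0 ≤ 2 * ∑ i, w i * (u i * b i)
    - (2 * α + c) * ∑ i, w i * b i ^ 2 by linarith)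
  linarith

/-- `(I - α B)⁻¹` has norm at most `1 / (1 - α)` for `‖·‖_W`. -/
lemma energy_resolvent_le (hA : A.rank = n) (hz : z ∈ posOrthant m) (hw : w ∈ posOrthant m)
    (hσ : ∀ i, leverage A z i ≤ w i) {α : ℝ} (hα : 0 ≤ α) (hα1 : α ≤ 1)
    {u y : Fin m → ℝ} (hy : ∀ i, y i = u i - α * scaledLaplacian A z w u i) :
    (1 - α) ^ 2 * ∑ i, w i * u i ^ 2 ≤ ∑ i, w i * y i ^ 2 := by
  have h1 := sum_mul_scaledLaplacian_le hA hz hw hσ u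
  set b := scaledLaplacian A z w u
  have h0 : 0 ≤ ∑ i, w i * (y i - (1 - α) * u i) ^ 2 :=
    Finset.sum_nonneg fun i _ => mul_nonneg (hw i).le (sq_nonneg _)
  have e : ∑ i, w i * (y i - (1 - α) * u i) ^ 2 = ∑ i, w i * y i ^ 2
      - (1 - α) ^ 2 * ∑ i, w i * u i ^ 2
      - 2 * (1 - α) * α * (∑ i, w i * u i ^ 2 - ∑ i, w i * (u i * b i)) := by
    simp only [Finset.mul_sum, ← Finset.sum_sub_distrib]
    exact Finset.sum_congr rfl fun i _ => by rw [hy]; ring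
  have h3 := mul_nonneg (mul_nonneg (mul_nonneg zero_le_two (sub_nonneg.2 hα1)) hα)
    (sub_nonneg.2 h1)
  linarith

/-- `‖W⁻¹ (P ∘ P) u‖_∞ ≤ ‖u‖_W`. -/
lemma abs_hadamard_sq_le (hA : A.rank = n) (hz : z ∈ posOrthant m)
    (hσ : ∀ i, leverage A z i ≤ w i) (u : Fin m → ℝ) (i : Fin m) :
    |∑ j, z i * z j * leverageKernel A z i j ^ 2 * u j|
      ≤ w i * √(∑ j, w j * u j ^ 2) := by
  have hq : ∀ j, 0 ≤ z i * z j * leverageKernel A z i j ^ 2 := fun j =>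
    mul_nonneg (mul_nonneg (hz i).le (hz j).le) (sq_nonneg _)
  have hσ0 := leverage_nonneg hA hz
  have h1 : (∑ j, z i * z j * leverageKernel A z i j ^ 2 * u j) ^ 2
      ≤ (∑ j, z i * z j * leverageKernel A z i j ^ 2)
        * ∑ j, z i * z j * leverageKernel A z i j ^ 2 * u j ^ 2 :=
    Finset.sum_sq_le_sum_mul_sum_of_sq_le_mul _ (fun j _ => hq j)
      (fun j _ => mul_nonneg (hq j) (sq_nonneg _)) fun j _ => le_of_eq (by ring)
  have h2 : ∑ j, z i * z j * leverageKernel A z i j ^ 2 * u j ^ 2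
      ≤ leverage A z i * ∑ j, w j * u j ^ 2 := by
    rw [Finset.mul_sum]
    refine Finset.sum_le_sum fun j _ => ?_
    rw [← mul_assoc]
    exact mul_le_mul_of_nonneg_right ((mul_leverageKernel_sq_le hA hz i j).trans
      (mul_le_mul_of_nonneg_left (hσ j) (hσ0 i))) (sq_nonneg _)
  rw [sum_mul_leverageKernel_sq_eq_leverage hA hz] at h1
  have h3 : (∑ j, z i * z j * leverageKernel A z i j ^ 2 * u j) ^ 2
      ≤ (leverage A z i) ^ 2 * ∑ j, w j * u j ^ 2 := by
    calc _ ≤ _ := h1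
      _ ≤ _ := mul_le_mul_of_nonneg_left h2 (hσ0 i)
      _ = _ := by ring
  calc _ ≤ √((leverage A z i) ^ 2 * ∑ j, w j * u j ^ 2) := Real.abs_le_sqrt h3
    _ = leverage A z i * √(∑ j, w j * u j ^ 2) := by
        rw [Real.sqrt_mul (sq_nonneg _), Real.sqrt_sq (hσ0 i)]
    _ ≤ _ := mul_le_mul_of_nonneg_right (hσ i) (Real.sqrt_nonneg _)

/-- Up to the energy of `u = (I - α B)⁻¹ y`, the matrix `I - c B (I - α B)⁻¹` does not increase
coordinates: its diagonal part lies in `[0, 1]`. -/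
lemma abs_resolvent_step_le (hA : A.rank = n) (hz : z ∈ posOrthant m) (hw : w ∈ posOrthant m)
    (hσ : ∀ i, leverage A z i ≤ w i) {α c : ℝ} (hα : 0 ≤ α) (hα1 : α < 1) (hc : 0 ≤ c)
    (hαc : α + c ≤ 1) {u y : Fin m → ℝ}
    (hy : ∀ i, y i = u i - α * scaledLaplacian A z w u i) (i : Fin m) :
    |y i - c * scaledLaplacian A z w u i| ≤ |y i| + √(∑ j, w j * u j ^ 2) := by
  have hp := abs_hadamard_sq_le hA hz hσ u i
  set U := √(∑ j, w j * u j ^ 2)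
  set q := ∑ j, z i * z j * leverageKernel A z i j ^ 2 * u j with hq
  set p := q / w i with hp'
  set t := leverage A z i / w i with ht
  have hwi := hw i
  have ht0 : 0 ≤ t := div_nonneg (leverage_nonneg hA hz i) hwi.le
  have ht1 : t ≤ 1 := (div_le_one hwi).2 (hσ i)
  have hb : scaledLaplacian A z w u i = t * u i - p := by
    rw [scaledLaplacian, leverageLaplacian, ← hq, sub_div, ht, hp']; ring
  have hpU : |p| ≤ U := by
    rw [hp', abs_div, abs_of_pos hwi, div_le_iff₀ hwi]; linarith
  have hD : 1 - α ≤ 1 - α * t := by nlinarith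
  have hD0 : 0 < 1 - α * t := by linarith
  have hyi := hy i
  rw [hb] at hyi ⊢
  have key : (1 - α * t) * (y i - c * (t * u i - p)) = (1 - α * t - c * t) * y i + c * p := by
    rw [hyi]; ring
  have hct : c * t ≤ 1 - α * t := by nlinarith
  refine le_of_mul_le_mul_left ?_ hD0
  calc (1 - α * t) * |y i - c * (t * u i - p)|
      = |(1 - α * t - c * t) * y i + c * p| := by rw [← key, abs_mul, abs_of_pos hD0]
    _ ≤ (1 - α * t - c * t) * |y i| + c * |p| := by
        refine (abs_add_le _ _).trans_eq ?_
        rw [abs_mul, abs_mul, abs_of_nonneg hc, abs_of_nonneg (sub_nonneg.2 hct)]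
    _ ≤ (1 - α * t) * |y i| + (1 - α * t) * U := by
        refine add_le_add (mul_le_mul_of_nonneg_right ?_ (abs_nonneg _))
          (mul_le_mul (by linarith) hpU (abs_nonneg _) hD0.le)
        nlinarith
    _ = _ := by ring

/-! ### Concavity of the logarithm of the determinant -/

lemma log_det_le_trace_sub {N : Matrix (Fin n) (Fin n) ℝ} (hN : N.PosDef) :
    Real.log N.det ≤ N.trace - n := by
  have h1 := hN.isHermitian.det_eq_prod_eigenvalues
  have h2 := hN.isHermitian.trace_eq_sum_eigenvalues
  simp only [RCLike.ofReal_real_eq_id, id] at h1 h2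
  rw [h1, h2, Real.log_prod fun i _ => (hN.eigenvalues_pos i).ne']
  have : (n : ℝ) = ∑ _i : Fin n, (1 : ℝ) := by simp
  rw [this, ← Finset.sum_sub_distrib]
  exact Finset.sum_le_sum fun i _ => Real.log_le_sub_one_of_pos (hN.eigenvalues_pos i)

/-- The tangent-plane inequality for the concave function `log det`. -/
lemma log_det_sub_log_det_le {M N : Matrix (Fin n) (Fin n) ℝ} (hM : M.PosDef) (hN : N.PosDef) :
    Real.log N.det - Real.log M.det ≤ (M⁻¹ * N).trace - n := by
  obtain ⟨C, hC⟩ : ∃ C : Matrix (Fin n) (Fin n) ℝ, M⁻¹ = Cᴴ * C := by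
    open scoped MatrixOrder in
    exact CStarAlgebra.nonneg_iff_eq_star_mul_self.1 hM.inv.posSemidef.nonneg
  have hdet : C.det * C.det * M.det = 1 := by
    have h := congrArg Matrix.det hC
    rw [det_nonsing_inv, Ring.inverse_eq_inv', det_mul, det_conjTranspose, star_trivial] at h
    rw [← h, inv_mul_cancel₀ hM.det_pos.ne']
  have hC0 : C.det ≠ 0 := fun h0 => by simp [h0] at hdet
  have hX : (C * N * Cᴴ).PosDef := by
    refine hN.mul_mul_conjTranspose_same ?_
    exact Matrix.vecMul_injective_iff_isUnit.2 ((Matrix.isUnit_iff_isUnit_det C).2 hC0.isUnit)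
  have h := log_det_le_trace_sub hX
  have e1 : (C * N * Cᴴ).trace = (M⁻¹ * N).trace := by
    rw [hC, Matrix.trace_mul_comm, Matrix.mul_assoc]
  have e2 : (C * N * Cᴴ).det = N.det / M.det := by
    rw [det_mul, det_mul, det_conjTranspose, star_trivial, eq_div_iff hM.det_pos.ne']
    linear_combination N.det * hdet
  rwa [e1, e2, Real.log_div hN.det_pos.ne' hM.det_pos.ne'] at h

/-! ### Differentiability of the leverage scores -/

section Deriv

-- Any submultiplicative matrix norm serves: the derivative only depends on the topology.
attribute [local instance] Matrix.linftyOpNormedRing Matrix.linftyOpNormedAlgebra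

/-- The leverage score is strictly differentiable; the formula comes from
`d(M⁻¹) = -M⁻¹ (dM) M⁻¹` with `M = Aᵀ Z A`. -/
lemma exists_hasStrictFDerivAt_leverage (hA : A.rank = n) (hz : z ∈ posOrthant m) (i : Fin m) :
    ∃ D : (Fin m → ℝ) →L[ℝ] ℝ, HasStrictFDerivAt (fun z => leverage A z i) D z ∧
      ∀ h, D h = h i * leverageKernel A z i i
        - z i * ∑ j, h j * leverageKernel A z i j ^ 2 := by
  let Γ : (Fin m → ℝ) →ₗ[ℝ] Matrix (Fin n) (Fin n) ℝ :=
    { toFun := gram A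
      map_add' := fun x y => by
        rw [gram, show diagonal (x + y) = diagonal x + diagonal y from (diagonal_add x y).symm,
          Matrix.mul_add, Matrix.add_mul, gram, gram]
      map_smul' := fun c x => by
        simp [gram, diagonal_smul] }
  let φ : Matrix (Fin n) (Fin n) ℝ →ₗ[ℝ] ℝ :=
    { toFun := fun N => (A * N * Aᵀ) i i
      map_add' := fun x y => by simp [Matrix.mul_add, Matrix.add_mul]
      map_smul' := fun c x => by simp }
  have hu := (Matrix.isUnit_iff_isUnit_det _).2 (isUnit_gram_det hA hz)
  have h1 : HasStrictFDerivAt Γ (LinearMap.toContinuousLinearMap Γ) z :=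
    (LinearMap.toContinuousLinearMap Γ).hasStrictFDerivAt
  have h2 := hasStrictFDerivAt_ringInverse (𝕜 := ℝ) hu.unit
  have h2' := HasStrictFDerivAt.comp (f := Γ) z h2 h1
  have h3 := ((LinearMap.toContinuousLinearMap φ).hasStrictFDerivAt).comp z h2'
  have h4 : HasStrictFDerivAt (fun z : Fin m → ℝ => z i)
    (ContinuousLinearMap.proj (R := ℝ) (φ := fun _ : Fin m => ℝ) i) z :=
    (ContinuousLinearMap.proj (R := ℝ) (φ := fun _ : Fin m => ℝ) i).hasStrictFDerivAt
  have h5 := h4.mul h3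
  refine ⟨_, h5.congr_of_eventuallyEq (Filter.Eventually.of_forall fun x => ?_), fun h => ?_⟩
  · simp only [leverage, leverageKernel, nonsing_inv_eq_ringInverse]
    rfl
  · have e1 : ((hu.unit⁻¹ : (Matrix (Fin n) (Fin n) ℝ)ˣ) : Matrix (Fin n) (Fin n) ℝ)
        = (gram A z)⁻¹ := by
      rw [Matrix.coe_units_inv]; rfl
    have e2 : φ (Ring.inverse (Γ z)) = leverageKernel A z i i := by
      rw [← nonsing_inv_eq_ringInverse]; rfl
    have e3 : φ ((gram A z)⁻¹ * gram A h * (gram A z)⁻¹)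
        = ∑ j, h j * leverageKernel A z i j ^ 2 := by
      have : A * ((gram A z)⁻¹ * gram A h * (gram A z)⁻¹) * Aᵀ
          = leverageKernel A z * diagonal h * leverageKernel A z := by
        simp only [leverageKernel, gram, Matrix.mul_assoc]
      change (A * ((gram A z)⁻¹ * gram A h * (gram A z)⁻¹) * Aᵀ) i i = _
      rw [this, Matrix.mul_apply]
      refine Finset.sum_congr rfl fun k _ => ?_
      rw [mul_diagonal, leverageKernel_comm A z k i]; ring
    change z i * φ (-((hu.unit⁻¹ : (Matrix (Fin n) (Fin n) ℝ)ˣ) * gram A h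
      * (hu.unit⁻¹ : (Matrix (Fin n) (Fin n) ℝ)ˣ))) + φ (Ring.inverse (Γ z)) * h i = _
    rw [e1, e2, map_neg, e3]
    ring

end Deriv

lemma continuousAt_leverage (hA : A.rank = n) (hz : z ∈ posOrthant m) (i : Fin m) :
    ContinuousAt (fun z => leverage A z i) z := by
  obtain ⟨D, hD, -⟩ := exists_hasStrictFDerivAt_leverage hA hz i
  exact hD.continuousAt

/-! ### Optimality conditions -/

/-- The weights `z = w^α / s²`, for which `A_sᵀ W^α A_s = Aᵀ Z A`. -/
def slackWeight (α : ℝ) (s w : Fin m → ℝ) (i : Fin m) : ℝ := w i ^ α / s i ^ 2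

lemma slackWeight_mem (hs : s ∈ posOrthant m) (hw : w ∈ posOrthant m) :
    slackWeight α s w ∈ posOrthant m :=
  fun i => div_pos (Real.rpow_pos_of_pos (hw i) _) (pow_pos (hs i) 2)

lemma diagonal_inv_eq (hs : s ∈ posOrthant m) :
    (diagonal s)⁻¹ = diagonal fun i => (s i)⁻¹ := by
  refine inv_eq_right_inv ?_
  rw [diagonal_mul_diagonal, ← diagonal_one]
  exact congrArg _ (funext fun i => mul_inv_cancel₀ (hs i).ne')

lemma scaledMatrix_gram (A : Matrix (Fin m) (Fin n) ℝ) (hs : s ∈ posOrthant m)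
    (v : Fin m → ℝ) :
    (scaledMatrix A s)ᵀ * diagonal v * scaledMatrix A s = gram A fun i => v i / s i ^ 2 := by
  have h : (diagonal fun i => (s i)⁻¹) * diagonal v * (diagonal fun i => (s i)⁻¹)
      = diagonal fun i => v i / s i ^ 2 := by
    rw [diagonal_mul_diagonal, diagonal_mul_diagonal]
    exact congrArg _ (funext fun i => by have := (hs i).ne'; field_simp)
  rw [gram, ← h, scaledMatrix, diagonal_inv_eq hs, transpose_mul, diagonal_transpose]
  simp only [Matrix.mul_assoc]

lemma weightObjective_eq (A : Matrix (Fin m) (Fin n) ℝ) (α β : ℝ) (hs : s ∈ posOrthant m)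
    (w : Fin m → ℝ) :
    weightObjective A α β s w = (∑ i, w i)
      - 1 / α * Real.log (gram A (slackWeight α s w)).det - β * ∑ i, Real.log (w i) := by
  rw [weightObjective, diagPow, scaledMatrix_gram A hs]
  rfl

/-- The optimality condition `w = σ(w^α / s²) + β`: the gradient of the objective vanishes. -/
def IsCriticalWeight (A : Matrix (Fin m) (Fin n) ℝ) (α β : ℝ) (s w : Fin m → ℝ) : Prop :=
  w ∈ posOrthant m ∧ ∀ i, w i = leverage A (slackWeight α s w) i + β

/-- Concavity of `log det (A_sᵀ W^α A_s)` in `w`, in tangent-plane form. -/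
lemma log_det_slackWeight_sub_le (hA : A.rank = n) (hα : 0 < α) (hα1 : α ≤ 1)
    (hs : s ∈ posOrthant m) {v : Fin m → ℝ} (hw : w ∈ posOrthant m) (hv : v ∈ posOrthant m) :
    Real.log (gram A (slackWeight α s v)).det - Real.log (gram A (slackWeight α s w)).det
      ≤ α * ∑ i, leverage A (slackWeight α s w) i / w i * (v i - w i) := by
  have hzw := slackWeight_mem (α := α) hs hw
  have hzv := slackWeight_mem (α := α) hs hv
  have h := log_det_sub_log_det_le (gram_posDef hA hzw) (gram_posDef hA hzv)
  rw [trace_gram_inv_mul_gram, ← sum_leverage hA hzw, ← Finset.sum_sub_distrib] at h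
  refine h.trans ?_
  rw [Finset.mul_sum]
  refine Finset.sum_le_sum fun i _ => ?_
  -- Bernoulli's inequality for `v^α = w^α (1 + (v - w) / w)^α`.
  have hwi := hw i
  have hB := rpow_one_add_le_one_add_mul_self (s := (v i - w i) / w i) (p := α)
    (by rw [le_div_iff₀ hwi]; linarith [hv i]) hα.le hα1
  have e : 1 + (v i - w i) / w i = v i / w i := by field_simp; ring
  rw [e, Real.div_rpow (hv i).le hwi.le, div_le_iff₀ (Real.rpow_pos_of_pos hwi _)] at hB
  have hz : slackWeight α s v i
      ≤ (1 + α * ((v i - w i) / w i)) * slackWeight α s w i := by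
    have := div_le_div_of_nonneg_right hB (pow_pos (hs i) 2).le
    rwa [mul_div_assoc] at this
  have h2 := mul_le_mul_of_nonneg_right hz (leverageKernel_diag_nonneg hA hzw i)
  unfold leverage
  refine (sub_le_sub_right h2 _).trans_eq ?_
  ring

/-- Tangent-plane inequality for the objective. -/
lemma le_weightObjective_sub (hA : A.rank = n) (hα : 0 < α) (hα1 : α ≤ 1)
    (hs : s ∈ posOrthant m) {v : Fin m → ℝ} (hw : w ∈ posOrthant m) (hv : v ∈ posOrthant m) :
    ∑ i, (w i - leverage A (slackWeight α s w) i - β) / w i * (v i - w i)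
        + β * ∑ i, (v i / w i - 1 - Real.log (v i / w i))
      ≤ weightObjective A α β s v - weightObjective A α β s w := by
  have h := log_det_slackWeight_sub_le hA hα hα1 hs hw hv
  rw [weightObjective_eq A α β hs, weightObjective_eq A α β hs]
  have h1 : 1 / α * (Real.log (gram A (slackWeight α s v)).det
      - Real.log (gram A (slackWeight α s w)).det)
      ≤ ∑ i, leverage A (slackWeight α s w) i / w i * (v i - w i) := by
    rw [one_div, inv_mul_le_iff₀ hα]; exact h
  have h2 : ∑ i, (w i - leverage A (slackWeight α s w) i - β) / w i * (v i - w i)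
        + β * ∑ i, (v i / w i - 1 - Real.log (v i / w i))
      = ∑ i, v i - ∑ i, w i - ∑ i, leverage A (slackWeight α s w) i / w i * (v i - w i)
        - β * (∑ i, Real.log (v i) - ∑ i, Real.log (w i)) := by
    simp only [Finset.mul_sum, ← Finset.sum_sub_distrib, ← Finset.sum_add_distrib]
    refine Finset.sum_congr rfl fun i _ => ?_
    rw [Real.log_div (hv i).ne' (hw i).ne']
    have := (hw i).ne'
    field_simp
    ring
  rw [h2]
  linarith

/-- By strict convexity, a critical weight vector is the strict global minimizer. -/
lemma IsCriticalWeight.weightObjective_lt (hA : A.rank = n) (hα : 0 < α) (hα1 : α ≤ 1)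
    (hβ : 0 < β) (hs : s ∈ posOrthant m) (hw : IsCriticalWeight A α β s w) {v : Fin m → ℝ}
    (hv : v ∈ posOrthant m) (hne : v ≠ w) :
    weightObjective A α β s w < weightObjective A α β s v := by
  have h := le_weightObjective_sub (β := β) hA hα hα1 hs hw.1 hv
  rw [Finset.sum_eq_zero, zero_add] at h
  · obtain ⟨i, hi⟩ := Function.ne_iff.1 hne
    have hpos : ∀ j, 0 < v j / w j := fun j => div_pos (hv j) (hw.1 j)
    have : 0 < ∑ j, (v j / w j - 1 - Real.log (v j / w j)) := by
      refine Finset.sum_pos' (fun j _ => sub_nonneg.2 (Real.log_le_sub_one_of_pos (hpos j)))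
        ⟨i, Finset.mem_univ i, sub_pos.2 (Real.log_lt_sub_one_of_pos (hpos i) fun he => hi ?_)⟩
      rwa [div_eq_one_iff_eq (hw.1 i).ne'] at he
    linarith [mul_pos hβ this]
  · intro i _
    have : w i - leverage A (slackWeight α s w) i - β = 0 := by linarith [hw.2 i]
    rw [this, zero_div, zero_mul]

lemma IsCriticalWeight.isOptimalWeight (hA : A.rank = n) (hα : 0 < α) (hα1 : α ≤ 1)
    (hβ : 0 < β) (hs : s ∈ posOrthant m) (hw : IsCriticalWeight A α β s w) :
    IsOptimalWeight A α β s w := by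
  refine ⟨hw.1, fun v hv => ?_⟩
  rcases eq_or_ne v w with rfl | hne
  · exact le_refl (weightObjective A α β s v)
  · exact (hw.weightObjective_lt hA hα hα1 hβ hs hv hne).le

lemma IsCriticalWeight.eq_of_isOptimalWeight (hA : A.rank = n) (hα : 0 < α) (hα1 : α ≤ 1)
    (hβ : 0 < β) (hs : s ∈ posOrthant m) (hw : IsCriticalWeight A α β s w) {v : Fin m → ℝ}
    (hv : IsOptimalWeight A α β s v) : v = w := by
  by_contra hne
  exact (hw.weightObjective_lt hA hα hα1 hβ hs hv.1 hne).not_ge (hv.2 hw.1)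

lemma continuousAt_slackWeight (s : Fin m → ℝ) (hw : w ∈ posOrthant m) :
    ContinuousAt (slackWeight α s) w := by
  refine continuousAt_pi.2 fun i => ?_
  refine ContinuousAt.div_const ?_ _
  exact (continuous_apply i).continuousAt.rpow_const (Or.inl (hw i).ne')

lemma continuousAt_weightObjective (hA : A.rank = n) (hs : s ∈ posOrthant m)
    (hw : w ∈ posOrthant m) : ContinuousAt (weightObjective A α β s) w := by
  rw [show weightObjective A α β s = _ from funext (weightObjective_eq A α β hs)]
  have hdet : ContinuousAt (fun w => (gram A (slackWeight α s w)).det) w := by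
    have : Continuous fun z : Fin m → ℝ => (gram A z).det := by
      unfold gram; fun_prop
    exact this.continuousAt.comp (continuousAt_slackWeight s hw)
  have hlog := hdet.log (gram_posDef hA (slackWeight_mem hs hw)).det_pos.ne'
  have hsum : ContinuousAt (fun w : Fin m → ℝ => ∑ i, w i) w := by fun_prop
  have hlogs : ContinuousAt (fun w : Fin m → ℝ => ∑ i, Real.log (w i)) w :=
    tendsto_finsetSum _ fun i _ => (continuous_apply i).continuousAt.log (hw i).ne'
  exact (hsum.sub (continuousAt_const.mul hlog)).sub (continuousAt_const.mul hlogs)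

/-- A minimizer over the box `[β, 1 + β]ᵐ` is already critical: the gradient at `w`, tested
against the point `σ(w^α / s²) + β` of the box, is `-∑ (σ_i + β - w_i)² / w_i`. -/
lemma exists_isCriticalWeight (hA : A.rank = n) (hα : 0 < α) (hα1 : α ≤ 1)
    (hβ : 0 < β) (hs : s ∈ posOrthant m) : ∃ w, IsCriticalWeight A α β s w := by
  set K : Set (Fin m → ℝ) := Set.Icc (fun _ => β) (fun _ => 1 + β) with hK
  have hKpos : ∀ w ∈ K, w ∈ posOrthant m := fun w hw i => hβ.trans_le (hw.1 i)
  obtain ⟨w, hwK, hmin⟩ := (isCompact_Icc : IsCompact K).exists_isMinOn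
    ⟨fun _ => β, fun _ => le_rfl, fun _ => by simp⟩
    fun w hw => (continuousAt_weightObjective (α := α) (β := β) hA hs
      (hKpos w hw)).continuousWithinAt
  have hw := hKpos w hwK
  have hz := slackWeight_mem (α := α) hs hw
  refine ⟨w, hw, ?_⟩
  set x : Fin m → ℝ := fun i => leverage A (slackWeight α s w) i + β with hx
  have hxK : x ∈ K := ⟨fun i => by simpa [hx] using leverage_nonneg hA hz i,
    fun i => by simpa [hx] using leverage_le_one hA hz i⟩
  -- The gradient at `v`, in the direction `x - w`.
  let F : (Fin m → ℝ) → ℝ := fun v =>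
    ∑ i, (v i - leverage A (slackWeight α s v) i - β) / v i * (x i - w i)
  have hF : ContinuousAt F w := by
    refine tendsto_finsetSum _ fun i _ => ?_
    have h1 : ContinuousAt (fun v => leverage A (slackWeight α s v) i) w :=
      (continuousAt_leverage hA hz i).comp (continuousAt_slackWeight s hw)
    have h2 : ContinuousAt (fun v : Fin m → ℝ => v i) w := (continuous_apply i).continuousAt
    exact (((h2.sub h1).sub continuousAt_const).div h2 (hw i).ne').mul continuousAt_const
  -- By convexity the gradient is nonnegative along the segment from `w` to `x`, hence at `w`.
  have hseg : ∀ t ∈ Set.Ioo (0 : ℝ) 1, 0 ≤ F (w + t • (x - w)) := by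
    intro t ht
    set v := w + t • (x - w) with hv
    have hvK : v ∈ K := by
      have := (convex_Icc (fun _ : Fin m => β) (fun _ => 1 + β)).add_smul_sub_mem hwK hxK
        ⟨ht.1.le, ht.2.le⟩
      exact this
    have hvp := hKpos v hvK
    have h := le_weightObjective_sub (β := β) hA hα hα1 hs hvp hw
    have h2 : weightObjective A α β s w ≤ weightObjective A α β s v := hmin hvK
    have h3 : 0 ≤ ∑ i, (w i / v i - 1 - Real.log (w i / v i)) :=
      Finset.sum_nonneg fun i _ =>
        sub_nonneg.2 (Real.log_le_sub_one_of_pos (div_pos (hw i) (hvp i)))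
    have h4 : ∑ i, (v i - leverage A (slackWeight α s v) i - β) / v i * (w i - v i)
        = -t * F v := by
      rw [Finset.mul_sum]
      refine Finset.sum_congr rfl fun i _ => ?_
      have : w i - v i = -t * (x i - w i) := by simp [hv]
      rw [this]; ring
    have h5 := mul_nonneg hβ.le h3
    rw [h4] at h
    have h6 : 0 ≤ t * F v := by linarith
    exact nonneg_of_mul_nonneg_right h6 ht.1
  have hlim : Filter.Tendsto (fun t : ℝ => F (w + t • (x - w))) (nhdsWithin 0 (Set.Ioi 0))
      (nhds (F w)) := by
    have hc : ContinuousAt (fun t : ℝ => w + t • (x - w)) 0 := by fun_prop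
    have hF' : ContinuousAt F (w + (0 : ℝ) • (x - w)) := by simpa using hF
    have := ContinuousAt.comp (f := fun t : ℝ => w + t • (x - w)) hF' hc
    have := this.tendsto.mono_left (nhdsWithin_le_nhds (s := Set.Ioi 0))
    simpa [Function.comp_def] using this
  have hFw : 0 ≤ F w := ge_of_tendsto hlim
    (Filter.mem_of_superset (Ioo_mem_nhdsGT one_pos) hseg)
  have hFw' : F w = -∑ i, (x i - w i) ^ 2 / w i := by
    rw [← Finset.sum_neg_distrib]
    refine Finset.sum_congr rfl fun i _ => ?_
    simp only [hx]; ring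
  have hnn : ∀ i ∈ Finset.univ, 0 ≤ (x i - w i) ^ 2 / w i := fun i _ =>
    div_nonneg (sq_nonneg _) (hw i).le
  have hzero : ∑ i, (x i - w i) ^ 2 / w i = 0 :=
    le_antisymm (by linarith) (Finset.sum_nonneg hnn)
  intro i
  have := (Finset.sum_eq_zero_iff_of_nonneg hnn).1 hzero i (Finset.mem_univ i)
  rw [div_eq_zero_iff, or_iff_left (hw i).ne', sq_eq_zero_iff, sub_eq_zero] at this
  exact this.symm

lemma isOptimalWeight_iff (hA : A.rank = n) (hα : 0 < α) (hα1 : α ≤ 1)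
    (hβ : 0 < β) (hs : s ∈ posOrthant m) :
    IsOptimalWeight A α β s w ↔ IsCriticalWeight A α β s w := by
  refine ⟨fun h => ?_, fun h => h.isOptimalWeight hA hα hα1 hβ hs⟩
  obtain ⟨v, hv⟩ := exists_isCriticalWeight hA hα hα1 hβ hs
  rwa [hv.eq_of_isOptimalWeight hA hα hα1 hβ hs h]

/-! ### Differentiability of the optimal weights -/

/-- The logarithm of the slacks `s` for which `w = σ(z) + β` is optimal with `w^α / s² = z`, as a
function of `ζ = log z`. -/
def logSlack (A : Matrix (Fin m) (Fin n) ℝ) (α β : ℝ) (ζ : Fin m → ℝ) (i : Fin m) : ℝ :=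
  (α * Real.log (leverage A (fun k => Real.exp (ζ k)) i + β) - ζ i) / 2

lemma exp_mem_posOrthant (ζ : Fin m → ℝ) : (fun k => Real.exp (ζ k)) ∈ posOrthant m :=
  fun _ => Real.exp_pos _

/-- The derivative of `logSlack` is `-(I - α B) / 2`. -/
lemma exists_hasStrictFDerivAt_logSlack (hA : A.rank = n) (hβ : 0 < β) {ζ : Fin m → ℝ}
    (hz : z = fun k => Real.exp (ζ k)) (hw : ∀ i, w i = leverage A z i + β) :
    ∃ D : (Fin m → ℝ) →L[ℝ] (Fin m → ℝ), HasStrictFDerivAt (logSlack A α β) D ζ ∧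
      ∀ h i, D h i = -(h i - α * scaledLaplacian A z w h i) / 2 := by
  have hzp : z ∈ posOrthant m := hz ▸ exp_mem_posOrthant ζ
  have hproj : ∀ i : Fin m, HasStrictFDerivAt (fun ζ : Fin m → ℝ => ζ i)
      (ContinuousLinearMap.proj (R := ℝ) (φ := fun _ : Fin m => ℝ) i) ζ := fun i =>
    (ContinuousLinearMap.proj (R := ℝ) (φ := fun _ : Fin m => ℝ) i).hasStrictFDerivAt
  have hexp : HasStrictFDerivAt (fun ζ : Fin m → ℝ => fun k => Real.exp (ζ k)) _ ζ :=
    hasStrictFDerivAt_pi.2 fun k => (hproj k).exp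
  have hcomp : ∀ i, ∃ D : (Fin m → ℝ) →L[ℝ] ℝ,
      HasStrictFDerivAt (fun ζ => logSlack A α β ζ i) D ζ ∧
      ∀ h, D h = -(h i - α * scaledLaplacian A z w h i) / 2 := by
    intro i
    obtain ⟨D, hD, hDh⟩ := exists_hasStrictFDerivAt_leverage hA hzp i
    have hw0 : leverage A z i + β ≠ 0 := by linarith [leverage_nonneg hA hzp i]
    subst hz
    have h1 := hD.comp (f := fun ζ : Fin m → ℝ => fun k => Real.exp (ζ k)) ζ hexp
    have h2 := (((h1.add_const β).log hw0).const_mul α).sub (hproj i)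
    have h3 := h2.mul_const ((2 : ℝ)⁻¹)
    refine ⟨_, h3, fun h => ?_⟩
    simp only [_root_.smul_apply, _root_.sub_apply,
      ContinuousLinearMap.comp_apply, hDh, ContinuousLinearMap.pi_apply,
      ContinuousLinearMap.proj_apply, smul_eq_mul, hw, scaledLaplacian, leverageLaplacian,
      leverage]
    have e : ∑ j, Real.exp (ζ i) * Real.exp (ζ j)
          * leverageKernel A (fun k => Real.exp (ζ k)) i j ^ 2 * h j
        = Real.exp (ζ i) * ∑ j, Real.exp (ζ j) * h j
          * leverageKernel A (fun k => Real.exp (ζ k)) i j ^ 2 := by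
      rw [Finset.mul_sum]
      exact Finset.sum_congr rfl fun j _ => by ring
    rw [e]
    ring
  choose D hD hDh using hcomp
  exact ⟨ContinuousLinearMap.pi D, hasStrictFDerivAt_pi.2 hD, fun h i => hDh i h⟩

/-- `I - α B` is invertible, so `logSlack` is a local diffeomorphism. -/
lemma exists_equiv_hasStrictFDerivAt_logSlack (hA : A.rank = n) (hα : 0 ≤ α) (hα1 : α < 1)
    (hβ : 0 < β) {ζ : Fin m → ℝ}
    (hz : z = fun k => Real.exp (ζ k)) (hw : ∀ i, w i = leverage A z i + β) :
    ∃ e : (Fin m → ℝ) ≃L[ℝ] (Fin m → ℝ),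
      HasStrictFDerivAt (logSlack A α β) (e : (Fin m → ℝ) →L[ℝ] (Fin m → ℝ)) ζ ∧
      ∀ h i, e h i = -(h i - α * scaledLaplacian A z w h i) / 2 := by
  obtain ⟨D, hD, hDh⟩ := exists_hasStrictFDerivAt_logSlack (α := α) hA hβ hz hw
  have hzp : z ∈ posOrthant m := hz ▸ exp_mem_posOrthant ζ
  have hwp : w ∈ posOrthant m := fun i => by
    rw [hw]; linarith [leverage_nonneg hA hzp i]
  have hinj : Function.Injective D.toLinearMap := by
    refine (injective_iff_map_eq_zero D.toLinearMap).2 fun h h0 => ?_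
    have h1 := energy_resolvent_le hA hzp hwp (fun i => by rw [hw]; linarith) hα hα1.le
      (u := h) (y := 0) fun i => by
        have := hDh h i
        rw [show D h = 0 from h0, Pi.zero_apply] at this
        rw [Pi.zero_apply]
        linarith
    have hnn : ∀ i ∈ Finset.univ, 0 ≤ w i * h i ^ 2 := fun i _ =>
      mul_nonneg (hwp i).le (sq_nonneg _)
    have hle : ∑ i, w i * h i ^ 2 ≤ 0 := by
      have : 0 < (1 - α) ^ 2 := pow_pos (by linarith) 2
      refine nonpos_of_mul_nonpos_right (h1.trans_eq ?_) this
      simp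
    funext i
    have := (Finset.sum_eq_zero_iff_of_nonneg hnn).1
      (le_antisymm hle (Finset.sum_nonneg hnn)) i (Finset.mem_univ i)
    simpa [(hwp i).ne'] using this
  let e := (LinearEquiv.ofInjectiveEndo D.toLinearMap hinj).toContinuousLinearEquiv
  have he : (e : (Fin m → ℝ) →L[ℝ] (Fin m → ℝ)) = D := by
    ext h i; rfl
  exact ⟨e, he ▸ hD, hDh⟩

lemma isCriticalWeight_exp_logSlack (hA : A.rank = n) (hβ : 0 < β) (ζ : Fin m → ℝ) :
    slackWeight α (fun k => Real.exp (logSlack A α β ζ k))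
        (fun k => leverage A (fun k => Real.exp (ζ k)) k + β) = (fun k => Real.exp (ζ k)) ∧
      IsCriticalWeight A α β (fun k => Real.exp (logSlack A α β ζ k))
        (fun k => leverage A (fun k => Real.exp (ζ k)) k + β) := by
  have hpos : ∀ i, 0 < leverage A (fun k => Real.exp (ζ k)) i + β := fun i => by
    linarith [leverage_nonneg hA (exp_mem_posOrthant ζ) i]
  have h : slackWeight α (fun k => Real.exp (logSlack A α β ζ k))
      (fun k => leverage A (fun k => Real.exp (ζ k)) k + β) = (fun k => Real.exp (ζ k)) := by
    funext i
    rw [slackWeight, Real.rpow_def_of_pos (hpos i), ← Real.exp_nat_mul, ← Real.exp_sub, logSlack]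
    congr 1
    push_cast
    ring
  exact ⟨h, hpos, fun i => by rw [h]⟩

/-- The logarithmic derivative of the optimal weights with respect to `log s` is
`-2 B (I - α B)⁻¹`. -/
lemma differentiableAt_optimalWeight (hA : A.rank = n) (hα : 0 < α) (hα1 : α < 1) (hβ : 0 < β)
    {g : (Fin m → ℝ) → (Fin m → ℝ)}
    (hg : ∀ s ∈ posOrthant m, IsCriticalWeight A α β s (g s)) (hs : s ∈ posOrthant m) :
    DifferentiableAt ℝ g s ∧ ∀ y : Fin m → ℝ, ∃ u : Fin m → ℝ,
      (∀ i, y i = u i - α * scaledLaplacian A (slackWeight α s (g s)) (g s) u i) ∧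
      ∀ i, fderiv ℝ g s (fun j => s j * y j) i
        = -2 * g s i * scaledLaplacian A (slackWeight α s (g s)) (g s) u i := by
  obtain ⟨hwp, hw⟩ := hg s hs
  have hzp := slackWeight_mem (α := α) hs hwp
  set z := slackWeight α s (g s) with hz
  have hzexp : z = fun k => Real.exp (Real.log (z k)) :=
    funext fun k => (Real.exp_log (hzp k)).symm
  obtain ⟨e, he, heh⟩ := exists_equiv_hasStrictFDerivAt_logSlack hA hα.le hα1 hβ hzexp hw
  -- The inverse of `logSlack`, expressed through `g`.
  let Z : (Fin m → ℝ) → (Fin m → ℝ) := fun ρ i =>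
    α * Real.log (g (fun k => Real.exp (ρ k)) i) - 2 * ρ i
  have hZ : ∀ ζ, Z (logSlack A α β ζ) = ζ := by
    intro ζ
    obtain ⟨h1, h2⟩ := isCriticalWeight_exp_logSlack (α := α) hA hβ ζ
    have hs' := exp_mem_posOrthant (logSlack A α β ζ)
    have h3 := h2.eq_of_isOptimalWeight hA hα hα1.le hβ hs'
      ((hg _ hs').isOptimalWeight hA hα hα1.le hβ hs')
    funext i
    change α * Real.log (g (fun k => Real.exp (logSlack A α β ζ k)) i)
      - 2 * logSlack A α β ζ i = ζ i
    rw [h3, logSlack]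
    ring
  have hlog : logSlack A α β (fun k => Real.log (z k)) = fun k => Real.log (s k) := by
    funext i
    rw [logSlack, ← hzexp, ← hw, hz, slackWeight,
      Real.log_div (Real.rpow_pos_of_pos (hwp i) _).ne' (pow_pos (hs i) 2).ne',
      Real.log_rpow (hwp i), Real.log_pow]
    push_cast
    ring
  have hZd := he.to_local_left_inverse (Filter.Eventually.of_forall hZ)
  rw [hlog] at hZd
  have hproj : ∀ i : Fin m, HasFDerivAt (fun s : Fin m → ℝ => s i)
      (ContinuousLinearMap.proj (R := ℝ) (φ := fun _ : Fin m => ℝ) i) s := fun i =>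
    (ContinuousLinearMap.proj (R := ℝ) (φ := fun _ : Fin m => ℝ) i).hasFDerivAt
  have hlogd : HasFDerivAt (fun s : Fin m → ℝ => fun k => Real.log (s k)) _ s :=
    hasFDerivAt_pi.2 fun k => (hproj k).log (hs k).ne'
  have hcomp := HasFDerivAt.comp (f := fun s : Fin m → ℝ => fun k => Real.log (s k)) s
    hZd.hasFDerivAt hlogd
  have hgd : HasFDerivAt (fun s : Fin m → ℝ => fun i =>
      Real.exp ((Z (fun k => Real.log (s k)) i + 2 * Real.log (s i)) * α⁻¹)) _ s :=
    hasFDerivAt_pi.2 fun i => HasFDerivAt.exp <| HasFDerivAt.mul_const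
      (HasFDerivAt.fun_add (f := fun s : Fin m → ℝ => Z (fun k => Real.log (s k)) i)
        (hasFDerivAt_pi'.1 hcomp i)
        (((hproj i).log (hs i).ne').const_mul 2)) α⁻¹
  have hval : ∀ s ∈ posOrthant m, ∀ i,
      Real.exp ((Z (fun k => Real.log (s k)) i + 2 * Real.log (s i)) * α⁻¹) = g s i := by
    intro s hs i
    have h1 : (fun k => Real.exp (Real.log (s k))) = s :=
      funext fun k => Real.exp_log (hs k)
    simp only [Z, h1]
    rw [sub_add_cancel, mul_comm α, mul_assoc, mul_inv_cancel₀ hα.ne', mul_one,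
      Real.exp_log ((hg s hs).1 i)]
  have hopen : posOrthant m ∈ nhds s := by
    have : IsOpen (posOrthant m) := by
      simp only [posOrthant, Set.ofPred_forall]
      exact isOpen_iInter_of_finite fun i => isOpen_lt continuous_const (continuous_apply i)
    exact this.mem_nhds hs
  have hgd' := hgd.congr_of_eventuallyEq (f₁ := g)
    (Filter.mem_of_superset hopen fun s hs => funext fun i => (hval s hs i).symm)
  refine ⟨hgd'.differentiableAt, fun y => ⟨(-(1 / 2) : ℝ) • e.symm y, fun i => ?_, fun i => ?_⟩⟩
  all_goals
    have hy := heh (e.symm y) i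
    rw [e.apply_symm_apply] at hy
    have hsm : scaledLaplacian A z (g s) ((-(1 / 2) : ℝ) • e.symm y) i
        = -(1 / 2) * scaledLaplacian A z (g s) (e.symm y) i := by
      simp only [scaledLaplacian, leverageLaplacian_smul]; ring
    rw [hsm]
  · simp only [Pi.smul_apply, smul_eq_mul]
    linarith
  · have hL : (fun k => (s k)⁻¹ * (s k * y k)) = y :=
      funext fun k => inv_mul_cancel_left₀ (hs k).ne' (y k)
    have hL2 : (ContinuousLinearMap.pi fun k =>
        (s k)⁻¹ • ContinuousLinearMap.proj (R := ℝ) (φ := fun _ : Fin m => ℝ) k)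
          (fun j => s j * y j) = y := hL
    rw [hgd'.fderiv]
    change Real.exp ((Z (fun k => Real.log (s k)) i + 2 * Real.log (s i)) * α⁻¹)
      * (α⁻¹ * (e.symm ((ContinuousLinearMap.pi fun k =>
        (s k)⁻¹ • ContinuousLinearMap.proj (R := ℝ) (φ := fun _ : Fin m => ℝ) k)
          (fun j => s j * y j)) i + 2 * ((s i)⁻¹ * (s i * y i)))) = _
    rw [hval s hs, hL2, inv_mul_cancel_left₀ (hs i).ne', hy]
    field_simp
    ring

lemma jacobian_mulVec (g : (Fin m → ℝ) → (Fin m → ℝ)) (s v : Fin m → ℝ) :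
    jacobian g s *ᵥ v = fderiv ℝ g s v := by
  have h : jacobian g s = LinearMap.toMatrix' (fderiv ℝ g s).toLinearMap := by
    ext i j
    simp [jacobian, LinearMap.toMatrix'_apply]
  rw [h, LinearMap.toMatrix'_mulVec]
  rfl

/-- The step matrix is `I - (2 / r) B (I - α B)⁻¹`. -/
lemma exists_stepMatrix_mulVec (hA : A.rank = n) (hα : 0 < α) (hα1 : α < 1) (hβ : 0 < β)
    {g : (Fin m → ℝ) → (Fin m → ℝ)}
    (hg : ∀ s ∈ posOrthant m, IsCriticalWeight A α β s (g s)) (hs : s ∈ posOrthant m)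
    (r : ℝ) (y : Fin m → ℝ) : ∃ u : Fin m → ℝ,
      (∀ i, y i = u i - α * scaledLaplacian A (slackWeight α s (g s)) (g s) u i) ∧
      ∀ i, (stepMatrix g s r *ᵥ y) i
        = y i - 2 / r * scaledLaplacian A (slackWeight α s (g s)) (g s) u i := by
  obtain ⟨u, hu, hu2⟩ := (differentiableAt_optimalWeight hA hα hα1 hβ hg hs).2 y
  refine ⟨u, hu, fun i => ?_⟩
  have hgi := ((hg s hs).1 i).ne'
  have h1 : diagonal s *ᵥ y = fun j => s j * y j := funext fun j => mulVec_diagonal s y j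
  rw [stepMatrix, add_mulVec, one_mulVec, smul_mulVec, ← mulVec_mulVec, ← mulVec_mulVec, h1,
    jacobian_mulVec, diagonal_inv_eq (hg s hs).1, Pi.add_apply, Pi.smul_apply, mulVec_diagonal,
    hu2, smul_eq_mul]
  field_simp
  ring

/-! ### The weight function properties -/

lemma energyNorm_diagonal (w y : Fin m → ℝ) :
    energyNorm (diagonal w) y = √(∑ i, w i * y i ^ 2) := by
  rw [energyNorm, dotProduct]
  congr 1
  exact Finset.sum_congr rfl fun i _ => by rw [mulVec_diagonal]; ring

lemma energyNorm_projMatrix (A : Matrix (Fin m) (Fin n) ℝ) (hs : s ∈ posOrthant m)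
    (hw : w ∈ posOrthant m) (i : Fin m) :
    energyNorm (projMatrix (scaledMatrix A s) w) (diagPow w (-(1 / 2)) *ᵥ Pi.single i 1)
      = √(leverageKernel A (fun k => w k / s k ^ 2) i i / s i ^ 2) := by
  have hED : diagPow w (1 / 2) * diagPow w (-(1 / 2)) = 1 := by
    rw [diagPow, diagPow, diagonal_mul_diagonal, ← diagonal_one]
    refine congrArg _ (funext fun k => ?_)
    rw [← Real.rpow_add (hw k), add_neg_cancel, Real.rpow_zero]
  have hDE : diagPow w (-(1 / 2)) * diagPow w (1 / 2) = 1 := by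
    rw [← hED, diagPow, diagPow, diagonal_mul_diagonal, diagonal_mul_diagonal]
    exact congrArg _ (funext fun k => mul_comm _ _)
  have hDt : (diagPow w (-(1 / 2)))ᵀ = diagPow w (-(1 / 2)) := diagonal_transpose _
  have key : diagPow w (-(1 / 2)) * projMatrix (scaledMatrix A s) w * diagPow w (-(1 / 2))
      = diagonal (fun k => (s k)⁻¹) * leverageKernel A (fun k => w k / s k ^ 2)
        * diagonal (fun k => (s k)⁻¹) := by
    rw [projMatrix, scaledMatrix_gram A hs]
    calc _ = (diagPow w (-(1 / 2)) * diagPow w (1 / 2)) * scaledMatrix A s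
          * (gram A fun k => w k / s k ^ 2)⁻¹ * (scaledMatrix A s)ᵀ
          * (diagPow w (1 / 2) * diagPow w (-(1 / 2))) := by simp only [Matrix.mul_assoc]
      _ = _ := by
          rw [hED, hDE, Matrix.one_mul, Matrix.mul_one, scaledMatrix, diagonal_inv_eq hs,
            transpose_mul, diagonal_transpose, leverageKernel]
          simp only [Matrix.mul_assoc]
  rw [energyNorm]
  congr 1
  calc _ = (Pi.single i 1) ⬝ᵥ ((diagPow w (-(1 / 2)) * projMatrix (scaledMatrix A s) w
        * diagPow w (-(1 / 2))) *ᵥ Pi.single i 1) := by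
        rw [← mulVec_mulVec, ← mulVec_mulVec, dotProduct_mulVec _ (diagPow w (-(1 / 2))),
          ← mulVec_transpose, hDt]
    _ = _ := by
        rw [key, single_one_dotProduct, mulVec_single_one, col_apply, mul_diagonal, diagonal_mul]
        field_simp

/-- Since `w ≥ β` and `β^{1 - α} = 1 / 2`, the weights `w` are at least half of `w^α`, which bounds
`a_iᵀ (A_sᵀ W A_s)⁻¹ a_i` by `2 σ_i / w_i^α`. -/
lemma slackSensitivity_le_two (hA : A.rank = n) (hm : 0 < m) (hα : 0 ≤ α) (hα1 : α ≤ 1)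
    (hβ : 0 < β) (hβα : β ^ (1 - α) = 1 / 2) (hs : s ∈ posOrthant m)
    (hw : IsCriticalWeight A α β s w) (hw2 : ∀ i, w i ≤ 2) :
    slackSensitivity A s w ≤ 2 := by
  obtain ⟨hwp, hwσ⟩ := hw
  have hz := slackWeight_mem (α := α) hs hwp
  have hz' : (fun k => w k / s k ^ 2) ∈ posOrthant m := fun k => div_pos (hwp k) (pow_pos (hs k) 2)
  have : Nonempty (Fin m) := ⟨⟨0, hm⟩⟩
  refine ciSup_le fun i => ?_
  rw [energyNorm_projMatrix A hs hwp]
  refine Real.sqrt_le_iff.2 ⟨zero_le_two, ?_⟩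
  have hsplit : ∀ k, w k = w k ^ (1 - α) * w k ^ α := fun k => by
    rw [← Real.rpow_add (hwp k), sub_add_cancel, Real.rpow_one]
  have hle : ∀ k, slackWeight α s w k ≤ 2 * (w k / s k ^ 2) := fun k => by
    have h1 : β ^ (1 - α) ≤ w k ^ (1 - α) :=
      Real.rpow_le_rpow hβ.le (by rw [hwσ]; linarith [leverage_nonneg hA hz k]) (by linarith)
    have h2 : w k ^ α ≤ 2 * w k := by
      nth_rewrite 2 [hsplit k]
      nlinarith [Real.rpow_pos_of_pos (hwp k) α]
    rw [slackWeight, ← mul_div_assoc]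
    exact div_le_div_of_nonneg_right h2 (pow_pos (hs k) 2).le
  have h1 := leverageKernel_diag_le hA hz hz' two_pos hle i
  have h2 : leverageKernel A (slackWeight α s w) i i * w i ^ α
      ≤ s i ^ 2 * (w i ^ (1 - α) * w i ^ α) := by
    have h3 : leverage A (slackWeight α s w) i ≤ w i := by rw [hwσ i]; linarith
    rw [leverage, slackWeight, div_mul_eq_mul_div, div_le_iff₀ (pow_pos (hs i) 2)] at h3
    rw [← hsplit]
    linarith
  have h4 : leverageKernel A (slackWeight α s w) i i ≤ s i ^ 2 * w i ^ (1 - α) :=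
    le_of_mul_le_mul_right (by linarith) (Real.rpow_pos_of_pos (hwp i) α)
  have h5 : w i ^ (1 - α) ≤ 2 := by
    calc w i ^ (1 - α) ≤ 2 ^ (1 - α) := Real.rpow_le_rpow (hwp i).le (hw2 i) (by linarith)
      _ ≤ 2 ^ (1 : ℝ) := Real.rpow_le_rpow_of_exponent_le one_le_two (by linarith)
      _ = 2 := Real.rpow_one 2
  rw [div_le_iff₀ (pow_pos (hs i) 2)]
  have h6 := mul_le_mul_of_nonneg_left h5 (pow_pos (hs i) 2).le
  linarith

/-- Any choice of critical weights is a weight function, for `α = 1 - 1 / L` and `β = 2^{-L}`. -/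
lemma isWeightFunction_of_isCriticalWeight (hA : A.rank = n) (hm : 0 < m) {L : ℝ} (hL : 1 < L)
    (hα : α = 1 - 1 / L) (hβ : β = 2 ^ (-L)) (hβm : m * β ≤ n)
    {g : (Fin m → ℝ) → (Fin m → ℝ)}
    (hg : ∀ s ∈ posOrthant m, IsCriticalWeight A α β s (g s)) :
    IsWeightFunction A g (2 * n) 2 (2 * L) := by
  have hL0 : 0 < L := by linarith
  have hLinv : 1 - α = 1 / L := by rw [hα]; ring
  have hα0 : 0 < α := by
    rw [hα, sub_pos, div_lt_one hL0]; exact hL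
  have hα1 : α < 1 := by
    have : 0 < 1 / L := by positivity
    linarith
  have hβ0 : 0 < β := hβ ▸ Real.rpow_pos_of_pos two_pos _
  have hβ1 : β ≤ 1 := hβ ▸ Real.rpow_le_one_of_one_le_of_nonpos one_le_two (by linarith)
  have hβα : β ^ (1 - α) = 1 / 2 := by
    rw [hβ, hLinv, ← Real.rpow_mul zero_le_two, show -L * (1 / L) = -1 by field_simp,
      Real.rpow_neg_one, one_div]
  have hzp : ∀ s ∈ posOrthant m, slackWeight α s (g s) ∈ posOrthant m := fun s hs =>
    slackWeight_mem hs (hg s hs).1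
  have hσ : ∀ s ∈ posOrthant m, ∀ i, leverage A (slackWeight α s (g s)) i ≤ g s i :=
    fun s hs i => by rw [(hg s hs).2 i]; linarith
  have hg2 : ∀ s ∈ posOrthant m, ∀ i, g s i ≤ 2 := fun s hs i => by
    rw [(hg s hs).2 i]; linarith [leverage_le_one hA (hzp s hs) i]
  have hr : ∀ r, 2 * L ≤ r → 0 ≤ 2 / r ∧ α + 2 / r ≤ 1 := fun r hr => by
    have hr0 : 0 < r := by linarith
    refine ⟨by positivity, ?_⟩
    have : 2 / r ≤ 1 / L := by
      rw [div_le_div_iff₀ hr0 hL0]; linarith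
    linarith
  refine ⟨fun s hs => (hg s hs).1,
    fun s hs => (differentiableAt_optimalWeight hA hα0 hα1 hβ0 hg hs).1, fun s hs => ?_,
    one_le_two, fun s hs => slackSensitivity_le_two hA hm hα0.le hα1.le hβ0 hβα hs (hg s hs)
      (hg2 s hs), by linarith, fun s hs r hrL => ?_, fun s hs r hrL y => ?_, fun s hs => ?_⟩
  · rw [Finset.sum_congr rfl fun i _ => (abs_of_pos ((hg s hs).1 i)).trans ((hg s hs).2 i),
      Finset.sum_add_distrib, sum_leverage hA (hzp s hs)]
    simp only [Finset.sum_const, Finset.card_univ, Fintype.card_fin, nsmul_eq_mul]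
    linarith
  · refine iSup₂_le fun y hy => ?_
    obtain ⟨u, hu, hstep⟩ := exists_stepMatrix_mulVec hA hα0 hα1 hβ0 hg hs r y
    refine ENNReal.ofReal_le_one.2 (le_trans ?_ hy)
    rw [energyNorm_diagonal, energyNorm_diagonal]
    refine Real.sqrt_le_sqrt ?_
    simp only [hstep]
    exact energy_resolvent_step_le hA (hzp s hs) (hg s hs).1 (hσ s hs) (hr r hrL).1 (hr r hrL).2 hu
  · obtain ⟨u, hu, hstep⟩ := exists_stepMatrix_mulVec hA hα0 hα1 hβ0 hg hs r y
    have hE : √(∑ j, g s j * u j ^ 2) ≤ L * energyNorm (diagonal (g s)) y := by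
      have h := energy_resolvent_le hA (hzp s hs) (hg s hs).1 (hσ s hs) hα0.le hα1.le hu
      rw [energyNorm_diagonal, ← Real.sqrt_sq hL0.le, ← Real.sqrt_mul (sq_nonneg L)]
      rw [hLinv, one_div, inv_pow, inv_mul_le_iff₀ (pow_pos hL0 2)] at h
      exact Real.sqrt_le_sqrt h
    have hE0 : 0 ≤ L * energyNorm (diagonal (g s)) y := mul_nonneg hL0.le (Real.sqrt_nonneg _)
    refine (pi_norm_le_iff_of_nonneg (by linarith [norm_nonneg y])).2 fun i => ?_
    rw [hstep, Real.norm_eq_abs]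
    have h1 := abs_resolvent_step_le hA (hzp s hs) (hg s hs).1 (hσ s hs) hα0.le hα1
      (hr r hrL).1 (hr r hrL).2 hu i
    have h2 := norm_le_pi_norm y i
    rw [Real.norm_eq_abs] at h2
    linarith
  · refine (pi_norm_le_iff_of_nonneg zero_le_two).2 fun i => ?_
    rw [Real.norm_eq_abs, abs_of_pos ((hg s hs).1 i)]
    exact hg2 s hs i

end WeightedPath

end

theorem mainTheorem3 (m n : ℕ) (A : Matrix (Fin m) (Fin n) ℝ) (α β : ℝ)
    (hfull : A.rank = n) (hpos : 0 < A.rank) (hlt : A.rank < m)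
    (hα : α = 1 - 1 / Real.logb 2 (2 * (m : ℝ) / (A.rank : ℝ)))
    (hβ : β = (A.rank : ℝ) / (2 * (m : ℝ))) :
    (∀ s ∈ WeightedPath.posOrthant m, ∃! w, WeightedPath.IsOptimalWeight A α β s w) ∧
    (∀ g : (Fin m → ℝ) → (Fin m → ℝ),
      (∀ s ∈ WeightedPath.posOrthant m, WeightedPath.IsOptimalWeight A α β s (g s)) →
      WeightedPath.IsWeightFunction A g (2 * (A.rank : ℝ)) 2
        (2 * Real.logb 2 (2 * (m : ℝ) / (A.rank : ℝ)))) := by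
  rw [hfull] at hpos hlt hα hβ ⊢
  have hn0 : (0 : ℝ) < n := Nat.cast_pos.2 hpos
  have hm : 0 < m := hpos.trans hlt
  have hm0 : (0 : ℝ) < m := Nat.cast_pos.2 hm
  have hnm : (n : ℝ) < m := Nat.cast_lt.2 hlt
  have hq : 2 < 2 * (m : ℝ) / n := by rw [lt_div_iff₀ hn0]; linarith
  set L := Real.logb 2 (2 * (m : ℝ) / n) with hLdef
  have hL : 1 < L := by
    rw [hLdef, Real.lt_logb_iff_rpow_lt one_lt_two (by linarith), Real.rpow_one]
    exact hq
  have hβL : β = 2 ^ (-L) := by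
    rw [Real.rpow_neg zero_le_two, hLdef,
      Real.rpow_logb two_pos (by norm_num) (by linarith), inv_div, hβ]
  have hβ0 : 0 < β := by rw [hβ]; positivity
  have hβm : m * β ≤ n := by
    rw [hβ]; field_simp; linarith
  have hα0 : 0 < α := by
    rw [hα, sub_pos, div_lt_one (by linarith)]; exact hL
  have hα1 : α ≤ 1 := by
    have : 0 < 1 / L := by positivity
    linarith
  refine ⟨fun s hs => ?_, fun g hg => ?_⟩
  · obtain ⟨w, hw⟩ := WeightedPath.exists_isCriticalWeight hfull hα0 hα1 hβ0 hs
    exact ⟨w, hw.isOptimalWeight hfull hα0 hα1 hβ0 hs,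
      fun v hv => hw.eq_of_isOptimalWeight hfull hα0 hα1 hβ0 hs hv⟩
  · exact WeightedPath.isWeightFunction_of_isCriticalWeight hfull hm hL hα hβL hβm fun s hs =>
      (WeightedPath.isOptimalWeight_iff hfull hα0 hα1 hβ0 hs).1 (hg s hs)
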